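/- Let $\mathbb T$ be the unit circle with normalized arclength measure, let $\chi(z)=z$ on $\mathbb T$, and let $\mathrm H^2\subset L^2(\mathbb T)$ be the classical Hardy space, i.e. the space of $f\in L^2(\mathbb T)$ whose negative Fourier coefficients all vanish. For a linear subspace $\mathcal V\subset\mathbb C\oplus\mathbb C\chi$ (the span of $1$ and $\chi$) put $\mathrm H^2_{\mathcal V}=\mathrm H^2\ominus\mathcal V$, the space of elements of $\mathrm H^2$ orthogonal to $\mathcal V$, and let $P_{\mathcal V}$ be the orthogonal projection of $L^2(\mathbb T)$ onto $\mathrm H^2_{\mathcal V}$. Let $\phi\in L^\infty(\mathbb T)$ be real-valued, and let $T^{\mathcal V}_\phi:\mathrm H^2_{\mathcal V}\to\mathrm H^2_{\mathcal V}$, $T^{\mathcal V}_\phi f=P_{\mathcal V}(\phi f)$, be the Toeplitz operator on $\mathrm H^2_{\mathcal V}$ with symbol $\phi$. A number $\lambda\in\mathbb C$ is called an eigenvalue of $\phi$ relative to the Neil algebra $\mathcal A$ (the algebra of all $f$ in the disc algebra with $f'(0)=0$) if there are a subspace $\mathcal V\subset\mathbb C\oplus\mathbb C\chi$ and a nonzero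 $g\in\mathrm H^2_{\mathcal V}$ with $T^{\mathcal V}_\phi g=\lambda g$. Then the set of eigenvalues of $\phi$ relative to $\mathcal A$ is either empty, a single real point, or a (nondegenerate) interval of real numbers. -/

import Mathlib

open MeasureTheory
open scoped ENNReal

noncomputable section

namespace NeilToeplitz

instance instFactTwoPiPos : Fact (0 < 2 * Real.pi) := ⟨Real.two_pi_pos⟩

/-- The unit circle, parametrized as `t ↦ e^{it}` by `ℝ / 2πℤ`. The monomial `z ^ n` restricted to
the circle is `fourier n`. -/
abbrev Torus : Type := AddCircle (2 * Real.pi)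

/-- Normalized arclength measure on the unit circle. -/
abbrev arc : Measure Torus := AddCircle.haarAddCircle

/-- The complex Hilbert space `L²` of the circle. -/
abbrev L2 : Type := Lp ℂ 2 arc

/-- The monomial `z ^ n` as an element of `L²`. -/
abbrev zpowL2 (n : ℤ) : L2 := fourierLp 2 n

/-- The classical Hardy space `H²` of the disc, identified through boundary values with the space
of all `L²` functions on the circle whose negative Fourier coefficients vanish. -/
def hardy : Submodule ℂ L2 where
  carrier := {f | ∀ n : ℤ, n < 0 → fourierCoeff (f : Torus → ℂ) n = 0}
  zero_mem' := by
    intro n _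
    rw [← fourierBasis_repr]
    simp
  add_mem' := by
    intro f g hf hg n hn
    have hf' := hf n hn
    have hg' := hg n hn
    rw [← fourierBasis_repr] at hf' hg' ⊢
    simp [hf', hg']
  smul_mem' := by
    intro c f hf n hn
    have hf' := hf n hn
    rw [← fourierBasis_repr] at hf' ⊢
    simp [hf']

theorem isClosed_hardy : IsClosed (hardy : Set L2) := by
  have h : (hardy : Set L2) =
      ⋂ (n : ℤ) (_ : n < 0), {f : L2 | inner ℂ (zpowL2 n) f = 0} := by
    ext f
    simp only [Set.mem_iInter, Set.mem_ofPred_eq]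
    refine forall₂_congr fun n _ => ?_
    rw [← fourierBasis_repr, HilbertBasis.repr_apply_apply, coe_fourierBasis]
  rw [h]
  exact isClosed_iInter fun n => isClosed_iInter fun _ =>
    isClosed_eq (continuous_const.inner continuous_id) continuous_const

/-- The two-dimensional space `ℂ ⊕ ℂ z` of polynomials of degree at most one, inside `H²`. -/
def affinePolys : Submodule ℂ L2 := Submodule.span ℂ {zpowL2 0, zpowL2 1}

/-- The space `H²_V = H² ⊖ V`: the elements of `H²` that are orthogonal to `V`. -/
def hardyMinus (V : Submodule ℂ L2) : Submodule ℂ L2 := hardy ⊓ Vᗮ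

instance instCompleteSpaceHardyMinus (V : Submodule ℂ L2) : CompleteSpace (hardyMinus V) := by
  have h : IsClosed (hardyMinus V : Set L2) := by
    simpa [hardyMinus] using isClosed_hardy.inter V.isClosed_orthogonal
  exact h.completeSpace_coe

/-- Multiplication by a real-valued `L^∞` function, as a bounded operator on `L²`. -/
def mulOp (φ : Lp ℝ ∞ arc) : L2 →L[ℂ] L2 :=
  LinearMap.mkContinuous
    { toFun := fun f => (φ • f : L2)
      map_add' := fun f g => Lp.add_smul φ f g
      map_smul' := by
        intro c f
        refine Lp.ext ?_
        filter_upwards [Lp.coeFn_lpSMul (r := 2) φ (c • f), Lp.coeFn_lpSMul (r := 2) φ f,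
          Lp.coeFn_smul c f, Lp.coeFn_smul c (φ • f : L2)] with x h1 h2 h3 h4
        simp only [RingHom.id_apply]
        rw [h1, h4]
        simp only [Pi.smul_apply, Pi.smul_apply', h2, h3]
        exact smul_comm _ _ _ }
    ‖φ‖ (fun f => Lp.norm_smul_le φ f)

/-- The Toeplitz operator with symbol `φ` on `H²_V`: `f ↦ P_V (φ f)`, where `P_V` is the orthogonal
projection of `L²` onto `H²_V`. -/
def toeplitz (φ : Lp ℝ ∞ arc) (V : Submodule ℂ L2) : hardyMinus V →L[ℂ] hardyMinus V :=
  (hardyMinus V).orthogonalProjectionOnto ∘L mulOp φ ∘L (hardyMinus V).subtypeL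

/-- The set of eigenvalues of `φ` relative to the Neil algebra: those complex `l` such that, for
some subspace `V` of `ℂ ⊕ ℂ z`, the equation `T g = l g` for the Toeplitz operator `T` on `H²_V`
with symbol `φ` has a nonzero solution `g` in `H²_V`. -/
def eigenvaluesNeil (φ : Lp ℝ ∞ arc) : Set ℂ :=
  {l | ∃ V : Submodule ℂ L2, V ≤ affinePolys ∧
    ∃ g : hardyMinus V, g ≠ 0 ∧ toeplitz φ V g = l • g}

end NeilToeplitz

end

/-! Write `z = e^{it}`. A real `x` is an eigenvalue exactly when some nonzero `g ∈ H²` is orthogonal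
to `(φ - x) g` and all Fourier coefficients of `(φ - x) g` of index at least `2` vanish. The real
function `(φ - x) |g|²` then has no Fourier coefficients of index other than `±1`, so it is of the
form `2 Re (c z)`; since `g ≠ 0` almost everywhere, `φ - x` has the sign of `2 Re (c z)`.

Let `x < ν < y`, where `x` and `y` are eigenvalues, with sign patterns `2 Re (c z)` and
`q = 2 Re (d z)`. Where `q > 0` we have `φ > y`. Where `q < 0`, the antipodal point has `φ > y > x`;
as `2 Re (c z)` is odd under the half turn, it is negative at the original point, so `φ < x` there.
Hence `δ |q| ≤ q (φ - ν)` for some `δ > 0`, and `(φ - ν) s² = q` for a bounded `s`. Removing from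
`s` its projection to the closed span of `z s, z² s, …` leaves a vector `u` orthogonal to `z u`, and
`g = conj (s u)` satisfies the criterion for `ν`: orthogonality to `z s, z² s, …` puts `g` in `H²`,
and `(φ - ν) s u` is a combination of `z` and `z⁻¹` plus an element of `H²`.
-/

open Filter Topology
open scoped ComplexConjugate

noncomputable section

namespace NeilToeplitz

section FourierUniqueness

theorem ae_eq_zero_of_forall_integral_boundedContinuous_smul_eq_zero {X E : Type*}
    [TopologicalSpace X] [MeasurableSpace X] [BorelSpace X] [HasOuterApproxClosed X]
    [NormedAddCommGroup E] [NormedSpace ℝ E] [CompleteSpace E] {μ : Measure X} {F : X → E}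
    (hF : Integrable F μ)
    (h : ∀ G : BoundedContinuousFunction X NNReal, ∫ x, (G x : ℝ) • F x ∂μ = 0) :
    F =ᵐ[μ] 0 := by
  refine ae_eq_zero_of_forall_setIntegral_isClosed_eq_zero hF fun s hs => ?_
  have tendsto_indicator (x : X) :
      Tendsto (fun n => (hs.apprSeq n x : ℝ) • F x) atTop (𝓝 (s.indicator F x)) := by
    have tendsto_apprSeq := tendsto_pi_nhds.1 (HasOuterApproxClosed.tendsto_apprSeq hs) x
    have tendsto_smul := ((NNReal.continuous_coe.tendsto _).comp tendsto_apprSeq).smul_const (F x)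
    by_cases hx : x ∈ s <;> simpa [hx] using tendsto_smul
  have tendsto_integral : Tendsto (fun n => ∫ x, (hs.apprSeq n x : ℝ) • F x ∂μ) atTop
      (𝓝 (∫ x in s, F x ∂μ)) := by
    rw [← integral_indicator hs.measurableSet]
    refine tendsto_integral_of_dominated_convergence (fun x => ‖F x‖) (fun n => ?_) hF.norm
      (fun n => ae_of_all _ fun x => ?_) (ae_of_all _ tendsto_indicator)
    · exact (NNReal.continuous_coe.comp (hs.apprSeq n).continuous).aestronglyMeasurable.smul
        hF.aestronglyMeasurable
    · rw [norm_smul, NNReal.norm_eq]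
      exact mul_le_of_le_one_left (norm_nonneg _)
        (mod_cast HasOuterApproxClosed.apprSeq_apply_le_one hs n x)
  simp only [h] at tendsto_integral
  exact tendsto_nhds_unique tendsto_integral tendsto_const_nhds

section ContinuousMap

variable {X E : Type*} [TopologicalSpace X] [CompactSpace X] [MeasurableSpace X]
  [OpensMeasurableSpace X] [NormedAddCommGroup E] [NormedSpace ℂ E] {μ : Measure X} {F : X → E}

theorem integrable_continuousMap_smul (hF : Integrable F μ) (G : C(X, ℂ)) :
    Integrable (fun x => G x • F x) μ :=
  hF.bdd_smul ‖G‖ G.continuous.aestronglyMeasurable (ae_of_all _ G.norm_coe_le_norm)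

theorem continuous_integral_continuousMap_smul (hF : Integrable F μ) :
    Continuous fun G : C(X, ℂ) => ∫ x, G x • F x ∂μ := by
  refine continuous_iff_continuousAt.2 fun G₀ => ?_
  refine continuousAt_of_dominated (bound := fun x => (‖G₀‖ + 1) * ‖F x‖)
    (Eventually.of_forall fun G => (integrable_continuousMap_smul hF G).aestronglyMeasurable) ?_
    (hF.norm.const_mul _)
    (ae_of_all _ fun x => ((continuous_eval_const x).smul continuous_const).continuousAt)
  filter_upwards [continuous_norm.continuousAt.eventually_le_const (lt_add_one ‖G₀‖)] with G hG
  refine ae_of_all _ fun x => ?_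
  rw [norm_smul]
  gcongr
  exact (G.norm_coe_le_norm x).trans hG

end ContinuousMap

variable {T : ℝ} [Fact (0 < T)]

theorem ae_eq_zero_of_fourierCoeff_eq_zero {E : Type*} [NormedAddCommGroup E] [NormedSpace ℂ E]
    [CompleteSpace E] {F : AddCircle T → E} (hF : Integrable F AddCircle.haarAddCircle)
    (h : fourierCoeff F = 0) : F =ᵐ[AddCircle.haarAddCircle] 0 := by
  let annihilator : Submodule ℂ C(AddCircle T, ℂ) :=
    { carrier := {G | ∫ t, G t • F t ∂AddCircle.haarAddCircle = 0}
      zero_mem' := by simp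
      add_mem' := fun {G H} hG hH => by
        simp only [Set.mem_ofPred_eq, ContinuousMap.add_apply, add_smul] at hG hH ⊢
        rw [integral_add (integrable_continuousMap_smul hF G) (integrable_continuousMap_smul hF H),
          hG, hH, add_zero]
      smul_mem' := fun c G hG => by
        simp only [Set.mem_ofPred_eq, ContinuousMap.smul_apply, smul_assoc] at hG ⊢
        rw [integral_smul, hG, smul_zero] }
  have annihilator_eq_top : annihilator = ⊤ := by
    rw [eq_top_iff, ← span_fourier_closure_eq_top]
    refine Submodule.topologicalClosure_minimal _ (Submodule.span_le.2 ?_)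
      (isClosed_eq (continuous_integral_continuousMap_smul hF) continuous_const)
    rintro _ ⟨n, rfl⟩
    have := congrFun h (-n)
    rw [fourierCoeff, neg_neg] at this
    exact this
  refine ae_eq_zero_of_forall_integral_boundedContinuous_smul_eq_zero hF fun G => ?_
  have : (⟨fun t => ((G t : ℝ) : ℂ), by fun_prop⟩ : C(AddCircle T, ℂ)) ∈ annihilator :=
    annihilator_eq_top ▸ Submodule.mem_top
  exact this

theorem ae_eq_sum_of_fourierCoeff_eq_zero {F : AddCircle T → ℂ}
    (hF : Integrable F AddCircle.haarAddCircle) (S : Finset ℤ)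
    (h : ∀ n ∉ S, fourierCoeff F n = 0) :
    F =ᵐ[AddCircle.haarAddCircle] ∑ n ∈ S, fourierCoeff F n • ⇑(fourier n) := by
  have integrable_term (n : ℤ) :
      Integrable (-fourierCoeff F n • ⇑(fourier n : C(AddCircle T, ℂ))) AddCircle.haarAddCircle :=
    ((fourier n).continuous.integrable_of_hasCompactSupport
      (HasCompactSupport.of_compactSpace _)).smul _
  have coeff_sub : fourierCoeff (F + ∑ n ∈ S, -fourierCoeff F n • ⇑(fourier n)) = 0 := by
    rw [fourierCoeff.add hF (integrable_finsetSum' _ fun n _ => integrable_term n),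
      fourierCoeff.sum _ _ fun n _ => integrable_term n]
    ext m
    simp only [Pi.add_apply, Finset.sum_apply, fourierCoeff.const_smul, fourierCoeff_fourier,
      Pi.single_apply, smul_eq_mul, mul_ite, mul_one, mul_zero, Finset.sum_ite_eq, Pi.zero_apply]
    by_cases hm : m ∈ S <;> simp [hm, h]
  filter_upwards [ae_eq_zero_of_fourierCoeff_eq_zero
    (hF.add (integrable_finsetSum' _ fun n _ => integrable_term n)) coeff_sub] with t ht
  simpa [← sub_eq_add_neg, sub_eq_zero] using ht

end FourierUniqueness

section FirstHarmonic

variable {T : ℝ}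

/-- The real trigonometric polynomial `c z + conj (c z)` on the circle, written as `2 Re (c z)`:
the form taken by `(φ - x) |g|²` when `g` is an eigenvector for the eigenvalue `x`. -/
def firstHarmonic (c : ℂ) (t : AddCircle T) : ℝ := 2 * (c * fourier 1 t).re

theorem ofReal_firstHarmonic (c : ℂ) (t : AddCircle T) :
    (firstHarmonic c t : ℂ) = c * fourier 1 t + conj c * fourier (-1) t := by
  rw [firstHarmonic, fourier_neg, ← map_mul, Complex.add_conj]

theorem continuous_firstHarmonic (c : ℂ) : Continuous (firstHarmonic c : AddCircle T → ℝ) := by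
  unfold firstHarmonic
  fun_prop

theorem firstHarmonic_zero (t : AddCircle T) : firstHarmonic 0 t = 0 := by
  simp [firstHarmonic]

theorem abs_firstHarmonic_le (c : ℂ) (t : AddCircle T) : |firstHarmonic c t| ≤ 2 * ‖c‖ := by
  have := Complex.abs_re_le_norm (c * fourier 1 t)
  rw [norm_mul, fourier_apply, Circle.norm_coe, mul_one] at this
  rw [firstHarmonic, abs_mul, abs_two, fourier_apply]
  gcongr

variable [hT : Fact (0 < T)]

theorem firstHarmonic_add_half_period (c : ℂ) (t : AddCircle T) :
    firstHarmonic c (t + ((T / 2 : ℝ) : AddCircle T)) = -firstHarmonic c t := by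
  have h := fourier_add_half_inv_index one_ne_zero hT.out t
  rw [Int.cast_one, div_one] at h
  rw [firstHarmonic, h, mul_neg, Complex.neg_re, mul_neg, firstHarmonic]

theorem fourierCoeff_ofReal_neg (F : AddCircle T → ℝ) (n : ℤ) :
    fourierCoeff (fun t => (F t : ℂ)) (-n) = conj (fourierCoeff (fun t => (F t : ℂ)) n) := by
  rw [fourierCoeff, fourierCoeff, ← integral_conj]
  simp only [smul_eq_mul, map_mul, Complex.conj_ofReal, ← fourier_neg]

theorem ae_eq_integral_add_firstHarmonic {F : AddCircle T → ℝ}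
    (hF : Integrable F AddCircle.haarAddCircle)
    (h : ∀ n : ℤ, 2 ≤ n → fourierCoeff (fun t => (F t : ℂ)) n = 0) :
    ∀ᵐ t ∂AddCircle.haarAddCircle, F t = (∫ t, F t ∂AddCircle.haarAddCircle) +
      firstHarmonic (fourierCoeff (fun t => (F t : ℂ)) 1) t := by
  have coeff_zero (n : ℤ) (hn : n ∉ ({0, 1, -1} : Finset ℤ)) :
      fourierCoeff (fun t => (F t : ℂ)) n = 0 := by
    simp only [Finset.mem_insert, Finset.mem_singleton] at hn
    obtain hn | hn : 2 ≤ n ∨ 2 ≤ -n := by lia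
    · exact h n hn
    · rw [← neg_neg n, fourierCoeff_ofReal_neg, h _ hn, map_zero]
  have mean : fourierCoeff (fun t => (F t : ℂ)) 0 = (∫ t, F t ∂AddCircle.haarAddCircle : ℝ) := by
    simp only [fourierCoeff, neg_zero, fourier_zero, one_smul, integral_complex_ofReal]
  filter_upwards [ae_eq_sum_of_fourierCoeff_eq_zero hF.ofReal _ coeff_zero] with t ht
  rw [← Complex.ofReal_inj, Complex.ofReal_add, ofReal_firstHarmonic, ← fourierCoeff_ofReal_neg,
    ← mean]
  refine ht.trans ?_
  simp

end FirstHarmonic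

section L2Operators

theorem inner_zpowL2_eq_fourierCoeff (n : ℤ) (f : L2) :
    inner ℂ (zpowL2 n) f = fourierCoeff f n := by
  rw [← fourierBasis_repr, HilbertBasis.repr_apply_apply, coe_fourierBasis]

theorem inner_zpowL2_zpowL2 (m n : ℤ) :
    inner ℂ (zpowL2 m) (zpowL2 n) = if m = n then 1 else 0 :=
  orthonormal_iff_ite.1 orthonormal_fourier m n

theorem eq_zero_of_forall_inner_zpowL2_eq_zero {f : L2}
    (h : ∀ n, inner ℂ (zpowL2 n) f = 0) : f = 0 := by
  refine fourierBasis.repr.map_eq_zero_iff.1 (lp.ext (funext fun n => ?_))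
  rw [HilbertBasis.repr_apply_apply, coe_fourierBasis, h, lp.coeFn_zero, Pi.zero_apply]

theorem inner_eq_integral (f g : L2) : inner ℂ f g = ∫ t, conj (f t) * g t ∂arc := by
  simp only [L2.inner_def, RCLike.inner_apply']

theorem coeFn_mulOp (φ : Lp ℝ ∞ arc) (f : L2) : mulOp φ f =ᵐ[arc] fun t => (φ t : ℂ) * f t := by
  filter_upwards [Lp.coeFn_lpSMul (r := 2) φ f] with t ht
  exact ht.trans (Complex.real_smul)

theorem inner_mulOp_left (φ : Lp ℝ ∞ arc) (f g : L2) :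
    inner ℂ (mulOp φ f) g = inner ℂ f (mulOp φ g) := by
  simp only [inner_eq_integral]
  refine integral_congr_ae ?_
  filter_upwards [coeFn_mulOp φ f, coeFn_mulOp φ g] with t hf hg
  rw [hf, hg, map_mul, Complex.conj_ofReal]
  ring

theorem mulOp_sub_const (φ : Lp ℝ ∞ arc) (x : ℝ) (f : L2) :
    mulOp (φ - Lp.const ∞ arc x) f = mulOp φ f - (x : ℂ) • f := by
  refine Lp.ext ?_
  filter_upwards [coeFn_mulOp (φ - Lp.const ∞ arc x) f, coeFn_mulOp φ f,
    Lp.coeFn_sub φ (Lp.const ∞ arc x), Lp.coeFn_const (p := ∞) (μ := arc) x,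
    Lp.coeFn_sub (mulOp φ f) ((x : ℂ) • f), Lp.coeFn_smul (x : ℂ) f] with t h₁ h₂ h₃ h₄ h₅ h₆
  rw [h₁, h₅, Pi.sub_apply, h₂, h₆, h₃, Pi.sub_apply, h₄, Function.const_apply, Pi.smul_apply,
    smul_eq_mul, Complex.ofReal_sub, sub_mul]

/-- Multiplication by `z ^ n` on `L²`, that is, the `n`-th power of the bilateral shift, encoded as
the Hölder product with the element `z ^ n` of `L^∞`. -/
def shift (n : ℤ) : L2 →L[ℂ] L2 :=
  (ContinuousLinearMap.mul ℂ ℂ).holderL arc ∞ 2 2 (fourierLp ∞ n)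

theorem coeFn_shift (n : ℤ) (f : L2) : shift n f =ᵐ[arc] fun t => fourier n t * f t := by
  filter_upwards [(ContinuousLinearMap.mul ℂ ℂ).coeFn_holder (r := 2) (fourierLp ∞ n) f,
    coeFn_fourierLp ∞ n] with t h₁ h₂
  refine h₁.trans ?_
  rw [h₂, ContinuousLinearMap.mul_apply']

theorem shift_mulOp (n : ℤ) (φ : Lp ℝ ∞ arc) (f : L2) :
    shift n (mulOp φ f) = mulOp φ (shift n f) := by
  refine Lp.ext ?_
  filter_upwards [coeFn_shift n (mulOp φ f), coeFn_mulOp φ f, coeFn_mulOp φ (shift n f),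
    coeFn_shift n f] with t h₁ h₂ h₃ h₄
  rw [h₁, h₂, h₃, h₄, mul_left_comm]

theorem shift_zpowL2 (n m : ℤ) : shift n (zpowL2 m) = zpowL2 (n + m) := by
  refine Lp.ext ?_
  filter_upwards [coeFn_shift n (zpowL2 m), coeFn_fourierLp 2 m, coeFn_fourierLp 2 (n + m)]
    with t h₁ h₂ h₃
  rw [h₁, h₂, h₃, fourier_add]

theorem shift_shift (n m : ℤ) (f : L2) : shift n (shift m f) = shift (n + m) f := by
  refine Lp.ext ?_
  filter_upwards [coeFn_shift n (shift m f), coeFn_shift m f, coeFn_shift (n + m) f]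
    with t h₁ h₂ h₃
  rw [h₁, h₂, h₃, fourier_add, mul_assoc]

theorem inner_shift_left (n : ℤ) (f g : L2) :
    inner ℂ (shift n f) g = fourierCoeff (fun t => conj (f t) * g t) n := by
  rw [inner_eq_integral, fourierCoeff]
  refine integral_congr_ae ?_
  filter_upwards [coeFn_shift n f] with t h
  rw [h, map_mul, fourier_neg, smul_eq_mul, mul_assoc]

theorem inner_shift_right (n : ℤ) (f g : L2) :
    inner ℂ f (shift n g) = inner ℂ (shift (-n) f) g := by
  simp only [inner_eq_integral]
  refine integral_congr_ae ?_
  filter_upwards [coeFn_shift n g, coeFn_shift (-n) f] with t hg hf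
  rw [hg, hf, map_mul, ← fourier_neg, neg_neg]
  ring

theorem inner_zpowL2_shift (m n : ℤ) (f : L2) :
    inner ℂ (zpowL2 m) (shift n f) = inner ℂ (zpowL2 (m - n)) f := by
  rw [inner_shift_right, shift_zpowL2, neg_add_eq_sub]

theorem star_mulOp (φ : Lp ℝ ∞ arc) (f : L2) : star (mulOp φ f) = mulOp φ (star f) := by
  refine Lp.ext ?_
  filter_upwards [Lp.coeFn_star (mulOp φ f), coeFn_mulOp φ f, coeFn_mulOp φ (star f),
    Lp.coeFn_star f] with t h₁ h₂ h₃ h₄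
  simp only [h₁, h₂, h₃, h₄, Pi.star_apply, RCLike.star_def, map_mul, Complex.conj_ofReal]

theorem inner_star_star (f g : L2) : inner ℂ (star f) (star g) = inner ℂ g f := by
  simp only [inner_eq_integral]
  refine integral_congr_ae ?_
  filter_upwards [Lp.coeFn_star f, Lp.coeFn_star g] with t hf hg
  simp only [hf, hg, Pi.star_apply, RCLike.star_def, Complex.conj_conj, mul_comm]

theorem star_L2_eq_zero_iff {f : L2} : star f = 0 ↔ f = 0 := by
  rw [← inner_self_eq_zero (𝕜 := ℂ), inner_star_star, inner_self_eq_zero]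

theorem star_zpowL2 (n : ℤ) : star (zpowL2 n) = zpowL2 (-n) := by
  refine Lp.ext ?_
  filter_upwards [Lp.coeFn_star (zpowL2 n), coeFn_fourierLp 2 n, coeFn_fourierLp 2 (-n)]
    with t h₁ h₂ h₃
  rw [h₁, Pi.star_apply, h₂, h₃, fourier_neg, RCLike.star_def]

theorem inner_zpowL2_star (n : ℤ) (f : L2) :
    inner ℂ (zpowL2 n) (star f) = inner ℂ f (zpowL2 (-n)) := by
  rw [← inner_star_star, star_star, star_zpowL2]

end L2Operators

section ZPowHardy

/-- The space `z ^ m H²` of the elements of `L²` whose Fourier coefficients of index less than `m`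
vanish. -/
def zpowHardy (m : ℤ) : Submodule ℂ L2 := (Submodule.span ℂ (zpowL2 '' Set.Iio m))ᗮ

theorem mem_zpowHardy_iff {m : ℤ} {f : L2} :
    f ∈ zpowHardy m ↔ ∀ n < m, inner ℂ (zpowL2 n) f = 0 := by
  rw [zpowHardy, ← Submodule.span_singleton_le_iff_mem, ← Submodule.isOrtho_iff_le,
    Submodule.isOrtho_comm, Submodule.isOrtho_span]
  simp only [Set.forall_mem_image, Set.mem_Iio, Set.mem_singleton_iff, forall_eq]

theorem isClosed_zpowHardy (m : ℤ) : IsClosed (zpowHardy m : Set L2) :=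
  Submodule.isClosed_orthogonal _

theorem hardy_eq_zpowHardy_zero : hardy = zpowHardy 0 := by
  ext f
  simp only [mem_zpowHardy_iff, inner_zpowL2_eq_fourierCoeff]
  rfl

theorem zpowL2_mem_zpowHardy {m n : ℤ} (h : m ≤ n) : zpowL2 n ∈ zpowHardy m :=
  mem_zpowHardy_iff.2 fun k hk => by
    rw [inner_zpowL2_zpowL2, if_neg (hk.trans_le h).ne]

theorem shift_mem_zpowHardy {m n : ℤ} {f : L2} (hf : f ∈ zpowHardy m) :
    shift n f ∈ zpowHardy (n + m) :=
  mem_zpowHardy_iff.2 fun k hk => by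
    rw [inner_zpowL2_shift, mem_zpowHardy_iff.1 hf _ (by lia)]

theorem mem_orthogonal_zpowHardy_iff {m : ℤ} {f : L2} :
    f ∈ (zpowHardy m)ᗮ ↔ ∀ n, m ≤ n → inner ℂ (zpowL2 n) f = 0 := by
  refine ⟨fun h n hn => h _ (zpowL2_mem_zpowHardy hn), fun h g hg => ?_⟩
  rw [← fourierBasis.tsum_inner_mul_inner, coe_fourierBasis]
  refine (tsum_congr fun n => ?_).trans tsum_zero
  obtain hn | hn := lt_or_ge n m
  · rw [inner_eq_zero_symm.1 (mem_zpowHardy_iff.1 hg n hn), zero_mul]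
  · rw [h n hn, mul_zero]

theorem zpowHardy_antitone : Antitone zpowHardy := fun _ _ h _ hf =>
  mem_zpowHardy_iff.2 fun k hk => mem_zpowHardy_iff.1 hf k (hk.trans_le h)

theorem affinePolys_le_orthogonal_zpowHardy_two : affinePolys ≤ (zpowHardy 2)ᗮ := by
  rw [affinePolys, Submodule.span_le, Set.insert_subset_iff, Set.singleton_subset_iff]
  constructor <;> refine mem_orthogonal_zpowHardy_iff.2 fun n hn => ?_ <;>
    rw [inner_zpowL2_zpowL2, if_neg (by lia)]

theorem zpowHardy_two_le_hardyMinus {V : Submodule ℂ L2} (hV : V ≤ affinePolys) :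
    zpowHardy 2 ≤ hardyMinus V := by
  refine le_inf (hardy_eq_zpowHardy_zero ▸ zpowHardy_antitone zero_le_two) ?_
  exact (Submodule.isOrtho_iff_le.2 (hV.trans affinePolys_le_orthogonal_zpowHardy_two)).symm

end ZPowHardy

section EigenvalueCriterion

theorem toeplitz_eq_smul_iff {φ : Lp ℝ ∞ arc} {V : Submodule ℂ L2} {g : hardyMinus V} {l : ℂ} :
    toeplitz φ V g = l • g ↔ mulOp φ g - l • (g : L2) ∈ (hardyMinus V)ᗮ := by
  rw [← Submodule.orthogonalProjectionOnto_eq_zero_iff, map_sub, map_smul,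
    Submodule.orthogonalProjectionOnto_mem_subspace_eq_self, sub_eq_zero]
  rfl

theorem sub_starProjection_affinePolys_mem_orthogonal_hardy [affinePolys.HasOrthogonalProjection]
    {w : L2} (hw : w ∈ (zpowHardy 2)ᗮ) : w - affinePolys.starProjection w ∈ hardyᗮ := by
  have mem_affine : w - affinePolys.starProjection w ∈ affinePolysᗮ :=
    Submodule.sub_starProjection_mem_orthogonal w
  have mem_two : w - affinePolys.starProjection w ∈ (zpowHardy 2)ᗮ :=
    sub_mem hw (affinePolys_le_orthogonal_zpowHardy_two (Submodule.starProjection_apply_mem _ _))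
  rw [hardy_eq_zpowHardy_zero, mem_orthogonal_zpowHardy_iff]
  intro n hn
  obtain rfl | rfl | hn : n = 0 ∨ n = 1 ∨ 2 ≤ n := by lia
  · exact mem_affine _ (Submodule.subset_span (Set.mem_insert _ _))
  · exact mem_affine _ (Submodule.subset_span (Set.mem_insert_of_mem _ rfl))
  · exact mem_orthogonal_zpowHardy_iff.1 mem_two n hn

theorem mem_eigenvaluesNeil_iff {φ : Lp ℝ ∞ arc} {l : ℂ} :
    l ∈ eigenvaluesNeil φ ↔ ∃ g ∈ hardy, g ≠ 0 ∧ inner ℂ g (mulOp φ g - l • g) = 0 ∧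
      mulOp φ g - l • g ∈ (zpowHardy 2)ᗮ := by
  constructor
  · rintro ⟨V, hV, g, hg, eigen⟩
    rw [toeplitz_eq_smul_iff] at eigen
    exact ⟨g, g.2.1, by simpa using hg, eigen g g.2,
      Submodule.orthogonal_le (zpowHardy_two_le_hardyMinus hV) eigen⟩
  · rintro ⟨g, g_mem, g_ne, inner_eq, w_mem⟩
    have : FiniteDimensional ℂ affinePolys := .span_of_finite ℂ (Set.toFinite _)
    set w := mulOp φ g - l • g
    set v := affinePolys.starProjection w
    have inner_v {h : L2} (hh : h ∈ hardy) : inner ℂ h v = inner ℂ h w := by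
      have := sub_starProjection_affinePolys_mem_orthogonal_hardy w_mem h hh
      rw [inner_sub_right, sub_eq_zero] at this
      exact this.symm
    have g_mem_minus : g ∈ hardyMinus (ℂ ∙ v) :=
      ⟨g_mem, Submodule.mem_orthogonal_singleton_iff_inner_left.2 ((inner_v g_mem).trans inner_eq)⟩
    refine ⟨ℂ ∙ v, ?_, ⟨g, g_mem_minus⟩, by simpa using g_ne, toeplitz_eq_smul_iff.2 ?_⟩
    · exact (Submodule.span_singleton_le_iff_mem _ _).2 (Submodule.starProjection_apply_mem _ _)
    · intro h hh
      exact (inner_v hh.1).symm.trans (Submodule.mem_orthogonal_singleton_iff_inner_left.1 hh.2)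

theorem conj_eq_self_of_mem_eigenvaluesNeil {φ : Lp ℝ ∞ arc} {l : ℂ}
    (hl : l ∈ eigenvaluesNeil φ) : conj l = l := by
  obtain ⟨g, -, g_ne, inner_eq, -⟩ := mem_eigenvaluesNeil_iff.1 hl
  rw [inner_sub_right, inner_smul_right, sub_eq_zero] at inner_eq
  refine mul_right_cancel₀ (inner_self_ne_zero (𝕜 := ℂ).2 g_ne) ?_
  rw [← inner_eq, ← inner_mulOp_left, ← inner_conj_symm (mulOp φ g), inner_eq, map_mul,
    inner_conj_symm]

theorem zero_mem_eigenvaluesNeil_iff {φ : Lp ℝ ∞ arc} :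
    0 ∈ eigenvaluesNeil φ ↔ ∃ g ∈ hardy, g ≠ 0 ∧ inner ℂ g (mulOp φ g) = 0 ∧
      mulOp φ g ∈ (zpowHardy 2)ᗮ := by
  simp only [mem_eigenvaluesNeil_iff, zero_smul, sub_zero]

theorem ofReal_mem_eigenvaluesNeil_iff {φ : Lp ℝ ∞ arc} {x : ℝ} :
    (x : ℂ) ∈ eigenvaluesNeil φ ↔ 0 ∈ eigenvaluesNeil (φ - Lp.const ∞ arc x) := by
  simp only [mem_eigenvaluesNeil_iff, mulOp_sub_const, zero_smul, sub_zero]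

end EigenvalueCriterion

section WanderingVector

/-- The closed span of `z f, z² f, z³ f, …`, that is, `z` times the closed shift-invariant subspace
generated by `f`. -/
def shiftSpan (f : L2) : Submodule ℂ L2 :=
  (Submodule.span ℂ ((fun n : ℤ => shift n f) '' Set.Ici 1)).topologicalClosure

instance instCompleteSpaceShiftSpan (f : L2) : CompleteSpace (shiftSpan f) :=
  Submodule.topologicalClosure.completeSpace _

/-- The component of `f` orthogonal to `z f, z² f, …`: the wandering vector of the invariant
subspace of the shift generated by `f`. -/
def wandering (f : L2) : L2 := f - (shiftSpan f).starProjection f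

theorem shift_mem_shiftSpan {f : L2} {n : ℤ} (hn : 1 ≤ n) : shift n f ∈ shiftSpan f :=
  Submodule.le_topologicalClosure _ (Submodule.subset_span (Set.mem_image_of_mem _ hn))

theorem shiftSpan_le {f : L2} {K : Submodule ℂ L2} (hK : IsClosed (K : Set L2))
    (h : ∀ n : ℤ, 1 ≤ n → shift n f ∈ K) : shiftSpan f ≤ K :=
  Submodule.topologicalClosure_minimal _
    (Submodule.span_le.2 (Set.image_subset_iff.2 fun n hn => h n hn)) hK

theorem sub_wandering_mem_shiftSpan (f : L2) : f - wandering f ∈ shiftSpan f := by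
  rw [wandering, sub_sub_cancel]
  exact Submodule.starProjection_apply_mem _ _

theorem wandering_mem {f : L2} {K : Submodule ℂ L2} (hK : IsClosed (K : Set L2)) (hf : f ∈ K)
    (h : ∀ n : ℤ, 1 ≤ n → shift n f ∈ K) : wandering f ∈ K :=
  sub_mem hf (shiftSpan_le hK h (Submodule.starProjection_apply_mem _ _))

theorem inner_shift_wandering_eq_zero {f : L2} {n : ℤ} (hn : 1 ≤ n) :
    inner ℂ (shift n f) (wandering f) = 0 :=
  Submodule.sub_starProjection_mem_orthogonal f _ (shift_mem_shiftSpan hn)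

theorem inner_shift_wandering_wandering_eq_zero {f : L2} {n : ℤ} (hn : 1 ≤ n) :
    inner ℂ (shift n (wandering f)) (wandering f) = 0 := by
  rw [← inner_conj_symm, map_eq_zero]
  set u := wandering f with u_def
  have : u ∈ (innerSL ℂ u ∘L shift n).ker := by
    rw [u_def]
    refine wandering_mem (ContinuousLinearMap.isClosed_ker _) ?_ fun k hk => ?_
    · exact inner_eq_zero_symm.1 (inner_shift_wandering_eq_zero hn)
    · rw [LinearMap.mem_ker, ContinuousLinearMap.coe_coe, ContinuousLinearMap.comp_apply,
        shift_shift]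
      exact inner_eq_zero_symm.1 (inner_shift_wandering_eq_zero (by lia))
  exact this

theorem integrable_norm_sq (f : L2) : Integrable (fun t => ‖f t‖ ^ 2) arc :=
  (Lp.memLp f).integrable_norm_pow two_ne_zero

theorem exists_ae_norm_sq_eq {u : L2} (h : ∀ n : ℤ, 1 ≤ n → inner ℂ (shift n u) u = 0) :
    ∃ a : ℝ, ∀ᵐ t ∂arc, ‖u t‖ ^ 2 = a := by
  have coeff_eq_zero (n : ℤ) (hn : 1 ≤ n) :
      fourierCoeff (fun t => ((‖u t‖ ^ 2 : ℝ) : ℂ)) n = 0 := by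
    rw [← h n hn, inner_shift_left]
    simp only [Complex.ofReal_pow, Complex.conj_mul']
  refine ⟨∫ t, ‖u t‖ ^ 2 ∂arc, ?_⟩
  filter_upwards [ae_eq_integral_add_firstHarmonic (integrable_norm_sq u) fun n hn =>
    coeff_eq_zero n (by lia)] with t ht
  rw [ht, coeff_eq_zero 1 le_rfl, firstHarmonic_zero, add_zero]

theorem ae_ne_zero_of_inner_shift_eq_zero {u : L2} (hu : u ≠ 0)
    (h : ∀ n : ℤ, 1 ≤ n → inner ℂ (shift n u) u = 0) : ∀ᵐ t ∂arc, u t ≠ 0 := by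
  obtain ⟨a, ha⟩ := exists_ae_norm_sq_eq h
  have a_ne : a ≠ 0 := by
    rintro rfl
    refine hu (Lp.ext ?_)
    filter_upwards [ha, Lp.coeFn_zero ℂ 2 arc] with t ht h₀
    simpa [h₀] using ht
  filter_upwards [ha] with t ht ut
  simp [← ht, ut] at a_ne

theorem mem_ker_LpToLpRestrictCLM_iff {X E 𝕜 : Type*} [MeasurableSpace X] [NormedField 𝕜]
    [NormedAddCommGroup E] [NormedSpace 𝕜 E] {μ : Measure X} {p : ℝ≥0∞} [Fact (1 ≤ p)]
    {s : Set X} (hs : MeasurableSet s) {f : Lp E p μ} :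
    f ∈ (LpToLpRestrictCLM X E 𝕜 μ p s).ker ↔ ∀ᵐ x ∂μ, x ∈ s → f x = 0 := by
  rw [LinearMap.mem_ker, ContinuousLinearMap.coe_coe, Lp.eq_zero_iff_ae_eq_zero,
    ← ae_restrict_iff' hs]
  exact (LpToLpRestrictCLM_coeFn 𝕜 s f).congr_left

theorem ae_wandering_eq_zero_of_eq_zero (f : L2) : ∀ᵐ t ∂arc, f t = 0 → wandering f t = 0 := by
  have hs : MeasurableSet {t | f t = 0} :=
    (Lp.stronglyMeasurable f).measurable (measurableSet_singleton 0)
  refine (mem_ker_LpToLpRestrictCLM_iff (𝕜 := ℂ) hs).1 (wandering_mem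
    (ContinuousLinearMap.isClosed_ker _) ((mem_ker_LpToLpRestrictCLM_iff hs).2 ?_)
    fun n _ => (mem_ker_LpToLpRestrictCLM_iff hs).2 ?_)
  · exact ae_of_all _ fun _ => id
  · filter_upwards [coeFn_shift n f] with t ht ft
    rw [ht, show f t = 0 from ft, mul_zero]

theorem ae_ne_zero_of_mem_zpowHardy {m : ℤ} {f : L2} (hf : f ∈ zpowHardy m)
    (hm : inner ℂ (zpowL2 m) f ≠ 0) : ∀ᵐ t ∂arc, f t ≠ 0 := by
  have sub_mem_zpowHardy : f - wandering f ∈ zpowHardy (m + 1) :=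
    shiftSpan_le (isClosed_zpowHardy _) (fun n hn =>
      zpowHardy_antitone (by lia) (shift_mem_zpowHardy hf)) (sub_wandering_mem_shiftSpan f)
  have wandering_ne_zero : wandering f ≠ 0 := by
    intro h
    rw [h, sub_zero] at sub_mem_zpowHardy
    exact hm (mem_zpowHardy_iff.1 sub_mem_zpowHardy m (by lia))
  filter_upwards [ae_ne_zero_of_inner_shift_eq_zero wandering_ne_zero fun n hn =>
    inner_shift_wandering_wandering_eq_zero hn, ae_wandering_eq_zero_of_eq_zero f] with t h₁ h₂ ft
  exact h₁ (h₂ ft)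

theorem ae_ne_zero_of_mem_hardy {f : L2} (hf : f ∈ hardy) (hne : f ≠ 0) :
    ∀ᵐ t ∂arc, f t ≠ 0 := by
  have exists_coeff : ∃ n : ℕ, inner ℂ (zpowL2 n) f ≠ 0 := by
    contrapose! hne
    refine eq_zero_of_forall_inner_zpowL2_eq_zero fun n => ?_
    obtain hn | hn := lt_or_ge n 0
    · exact mem_zpowHardy_iff.1 (hardy_eq_zpowHardy_zero ▸ hf) n hn
    · lift n to ℕ using hn
      exact hne n
  classical
  refine ae_ne_zero_of_mem_zpowHardy (mem_zpowHardy_iff.2 fun n hn => ?_)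
    (Nat.find_spec exists_coeff)
  obtain hn₀ | hn₀ := lt_or_ge n 0
  · exact mem_zpowHardy_iff.1 (hardy_eq_zpowHardy_zero ▸ hf) n hn₀
  · lift n to ℕ using hn₀
    exact not_not.1 (Nat.find_min exists_coeff (mod_cast hn))

end WanderingVector

section SignOfSymbol

theorem ae_mul_norm_sq_eq_firstHarmonic {ψ : Lp ℝ ∞ arc} {g : L2} (hg : g ∈ hardy)
    (inner_eq : inner ℂ g (mulOp ψ g) = 0) (hψg : mulOp ψ g ∈ (zpowHardy 2)ᗮ) :
    ∃ c : ℂ, ∀ᵐ t ∂arc, ψ t * ‖g t‖ ^ 2 = firstHarmonic c t := by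
  have ofReal_eq : (fun t => ((ψ t * ‖g t‖ ^ 2 : ℝ) : ℂ)) =ᵐ[arc]
      fun t => conj (g t) * mulOp ψ g t := by
    filter_upwards [coeFn_mulOp ψ g] with t ht
    rw [ht, mul_left_comm, Complex.conj_mul', Complex.ofReal_mul, Complex.ofReal_pow]
  have integrable : Integrable (fun t => ψ t * ‖g t‖ ^ 2) arc := by
    have := (L2.integrable_inner (𝕜 := ℂ) g (mulOp ψ g)).re
    refine this.congr (ofReal_eq.mono fun t ht => ?_)
    simp only [RCLike.inner_apply', ← ht, RCLike.re_to_complex, Complex.ofReal_re]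
  have coeff_eq_zero (n : ℤ) (hn : 2 ≤ n) :
      fourierCoeff (fun t => ((ψ t * ‖g t‖ ^ 2 : ℝ) : ℂ)) n = 0 := by
    rw [fourierCoeff_congr_ae ofReal_eq, ← inner_shift_left]
    rw [hardy_eq_zpowHardy_zero] at hg
    exact hψg _ (zpowHardy_antitone (by lia) (shift_mem_zpowHardy hg))
  have mean_eq_zero : ∫ t, ψ t * ‖g t‖ ^ 2 ∂arc = 0 := by
    rw [← Complex.ofReal_eq_zero, ← integral_complex_ofReal, integral_congr_ae ofReal_eq,
      ← inner_eq_integral, inner_eq]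
  have := ae_eq_integral_add_firstHarmonic integrable coeff_eq_zero
  simp only [mean_eq_zero, zero_add] at this
  exact ⟨_, this⟩

theorem exists_ae_sign_sub_eq_sign_firstHarmonic {φ : Lp ℝ ∞ arc} {x : ℝ}
    (hx : (x : ℂ) ∈ eigenvaluesNeil φ) :
    ∃ c : ℂ, ∀ᵐ t ∂arc, SignType.sign (φ t - x) = SignType.sign (firstHarmonic c t) := by
  obtain ⟨g, g_mem, g_ne, inner_eq, mem_orthogonal⟩ :=
    zero_mem_eigenvaluesNeil_iff.1 (ofReal_mem_eigenvaluesNeil_iff.1 hx)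
  obtain ⟨c, hc⟩ := ae_mul_norm_sq_eq_firstHarmonic g_mem inner_eq mem_orthogonal
  refine ⟨c, ?_⟩
  filter_upwards [hc, ae_ne_zero_of_mem_hardy g_mem g_ne, Lp.coeFn_sub φ (Lp.const ∞ arc x),
    Lp.coeFn_const (p := ∞) (μ := arc) x] with t ht gt h_sub h_const
  rw [← ht, sign_mul, sign_pos (by positivity : 0 < ‖g t‖ ^ 2), mul_one, h_sub, Pi.sub_apply,
    h_const, Function.const_apply]

end SignOfSymbol

section Existence

theorem mulOp_mulOp_mulOp_eq {ψ s : Lp ℝ ∞ arc} {d : ℂ}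
    (h : ∀ᵐ t ∂arc, ψ t * s t ^ 2 = firstHarmonic d t) (f : L2) :
    mulOp ψ (mulOp s (mulOp s f)) = d • shift 1 f + conj d • shift (-1) f := by
  refine Lp.ext ?_
  filter_upwards [h, coeFn_mulOp ψ (mulOp s (mulOp s f)), coeFn_mulOp s (mulOp s f),
    coeFn_mulOp s f, Lp.coeFn_add (d • shift 1 f) (conj d • shift (-1) f),
    Lp.coeFn_smul d (shift 1 f), Lp.coeFn_smul (conj d) (shift (-1) f), coeFn_shift 1 f,
    coeFn_shift (-1) f] with t ht h₁ h₂ h₃ h₄ h₅ h₆ h₇ h₈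
  have := ofReal_firstHarmonic d t
  rw [← ht, Complex.ofReal_mul, Complex.ofReal_pow] at this
  rw [h₁, h₂, h₃, h₄, Pi.add_apply, h₅, h₆, Pi.smul_apply, Pi.smul_apply, h₇, h₈, smul_eq_mul,
    smul_eq_mul]
  linear_combination this * f t

theorem mulOp_comm (φ ψ : Lp ℝ ∞ arc) (f : L2) : mulOp φ (mulOp ψ f) = mulOp ψ (mulOp φ f) := by
  refine Lp.ext ?_
  filter_upwards [coeFn_mulOp φ (mulOp ψ f), coeFn_mulOp ψ f, coeFn_mulOp ψ (mulOp φ f),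
    coeFn_mulOp φ f] with t h₁ h₂ h₃ h₄
  rw [h₁, h₂, h₃, h₄, mul_left_comm]

theorem star_mulOp_wandering_mem_hardy (s : Lp ℝ ∞ arc) :
    star (mulOp s (wandering (mulOp s (zpowL2 0)))) ∈ hardy := by
  rw [hardy_eq_zpowHardy_zero, mem_zpowHardy_iff]
  intro n hn
  rw [inner_zpowL2_star, inner_mulOp_left, ← add_zero (-n), ← shift_zpowL2, ← shift_mulOp]
  exact inner_eq_zero_symm.1 (inner_shift_wandering_eq_zero (by lia))

theorem mulOp_mulOp_sub_wandering_mem_zpowHardy {ψ s : Lp ℝ ∞ arc} {d : ℂ}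
    (h : ∀ᵐ t ∂arc, ψ t * s t ^ 2 = firstHarmonic d t) :
    mulOp ψ (mulOp s (mulOp s (zpowL2 0) - wandering (mulOp s (zpowL2 0)))) ∈ zpowHardy 0 := by
  refine shiftSpan_le (K := (zpowHardy 0).comap (mulOp ψ ∘L mulOp s : L2 →ₗ[ℂ] L2))
    ((isClosed_zpowHardy 0).preimage (mulOp ψ ∘L mulOp s).continuous) (fun n hn => ?_)
    (sub_wandering_mem_shiftSpan _)
  rw [shift_mulOp, shift_zpowL2, Submodule.mem_comap, ContinuousLinearMap.coe_coe,
    ContinuousLinearMap.comp_apply, mulOp_mulOp_mulOp_eq h, shift_zpowL2, shift_zpowL2]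
  exact add_mem (Submodule.smul_mem _ _ (zpowL2_mem_zpowHardy (by lia)))
    (Submodule.smul_mem _ _ (zpowL2_mem_zpowHardy (by lia)))

theorem zero_mem_eigenvaluesNeil_of_mul_sq_eq {ψ s : Lp ℝ ∞ arc} {d : ℂ} (hd : d ≠ 0)
    (h : ∀ᵐ t ∂arc, ψ t * s t ^ 2 = firstHarmonic d t) : 0 ∈ eigenvaluesNeil ψ := by
  have g_mem := star_mulOp_wandering_mem_hardy s
  have sub_mem := mulOp_mulOp_sub_wandering_mem_zpowHardy h
  rw [map_sub, map_sub, mulOp_mulOp_mulOp_eq h, shift_zpowL2, shift_zpowL2] at sub_mem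
  have inner_shift : inner ℂ (shift 1 (wandering (mulOp s (zpowL2 0)))) _ = 0 :=
    inner_shift_wandering_wandering_eq_zero le_rfl
  set u := wandering (mulOp s (zpowL2 0))
  refine zero_mem_eigenvaluesNeil_iff.2 ⟨star (mulOp s u), g_mem, fun g_eq => ?_, ?_, ?_⟩
  · rw [star_L2_eq_zero_iff.1 g_eq, map_zero, sub_zero] at sub_mem
    have coeff := mem_zpowHardy_iff.1 sub_mem (-1) (by lia)
    rw [inner_add_right, inner_smul_right, inner_smul_right, inner_zpowL2_zpowL2,
      inner_zpowL2_zpowL2, if_neg (by lia), if_pos (by lia), mul_zero, zero_add, mul_one] at coeff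
    exact hd ((map_eq_zero _).1 coeff)
  · rw [← star_mulOp, inner_star_star, ← inner_mulOp_left s, mulOp_comm s ψ,
      mulOp_mulOp_mulOp_eq h, inner_add_left, inner_smul_left, inner_smul_left, inner_shift,
      ← inner_shift_right, inner_eq_zero_symm.1 inner_shift, mul_zero, mul_zero, add_zero]
  · have mem_neg_one : mulOp ψ (mulOp s u) ∈ zpowHardy (-1) := by
      refine (Submodule.sub_mem_iff_right _ ?_).1 (zpowHardy_antitone (by lia) sub_mem)
      exact add_mem (Submodule.smul_mem _ _ (zpowL2_mem_zpowHardy (by lia)))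
        (Submodule.smul_mem _ _ (zpowL2_mem_zpowHardy (by lia)))
    refine mem_orthogonal_zpowHardy_iff.2 fun n hn => ?_
    rw [← star_mulOp, inner_zpowL2_star]
    exact inner_eq_zero_symm.1 (mem_zpowHardy_iff.1 mem_neg_one _ (by lia))

end Existence

section SquareRoot

theorem div_nonneg_and_le_of_mul_abs_le {δ a b : ℝ} (hδ : 0 < δ) (h : δ * |a| ≤ a * b) :
    0 ≤ a / b ∧ a / b ≤ |a| / δ := by
  have mul_nonneg : 0 ≤ a * b := (mul_nonneg hδ.le (abs_nonneg a)).trans h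
  refine ⟨div_nonneg_iff.2 (mul_nonneg_iff.1 mul_nonneg), ?_⟩
  obtain rfl | ha := eq_or_ne a 0
  · simp
  have le_abs : δ ≤ |b| := by
    rw [← abs_of_nonneg mul_nonneg, abs_mul, mul_comm] at h
    exact le_of_mul_le_mul_left h (abs_pos.2 ha)
  calc a / b ≤ |a / b| := le_abs_self _
    _ = |a| / |b| := abs_div a b
    _ ≤ |a| / δ := by gcongr

theorem exists_Lp_top_ae_mul_sq_eq {X : Type*} [MeasurableSpace X] {μ : Measure X} {ψ q : X → ℝ}
    {C δ : ℝ} (hψ : AEMeasurable ψ μ) (hq : AEMeasurable q μ) (hC : ∀ᵐ x ∂μ, |q x| ≤ C)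
    (hδ : 0 < δ) (h : ∀ᵐ x ∂μ, δ * |q x| ≤ q x * ψ x) :
    ∃ s : Lp ℝ ∞ μ, ∀ᵐ x ∂μ, ψ x * s x ^ 2 = q x := by
  have bound : ∀ᵐ x ∂μ, ‖√(q x / ψ x)‖ ≤ √(C / δ) := by
    filter_upwards [h, hC] with x hx hCx
    rw [Real.norm_of_nonneg (Real.sqrt_nonneg _)]
    refine Real.sqrt_le_sqrt ((div_nonneg_and_le_of_mul_abs_le hδ hx).2.trans ?_)
    gcongr
  have memLp : MemLp (fun x => √(q x / ψ x)) ∞ μ :=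
    memLp_top_of_bound (hq.div hψ).sqrt.aestronglyMeasurable _ bound
  refine ⟨memLp.toLp, ?_⟩
  filter_upwards [memLp.coeFn_toLp, h] with x hs hx
  rw [hs, Real.sq_sqrt (div_nonneg_and_le_of_mul_abs_le hδ hx).1]
  obtain q_eq | q_ne := eq_or_ne (q x) 0
  · rw [q_eq, zero_div, mul_zero]
  · refine mul_div_cancel₀ _ (right_ne_zero_of_mul (a := q x) ?_)
    exact ((mul_pos hδ (abs_pos.2 q_ne)).trans_le hx).ne'

end SquareRoot

section Intervals

theorem zero_mem_eigenvaluesNeil_of_le_mul {ψ : Lp ℝ ∞ arc} {d : ℂ} {δ : ℝ} (hd : d ≠ 0)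
    (hδ : 0 < δ) (h : ∀ᵐ t ∂arc, δ * |firstHarmonic d t| ≤ firstHarmonic d t * ψ t) :
    0 ∈ eigenvaluesNeil ψ := by
  obtain ⟨s, hs⟩ := exists_Lp_top_ae_mul_sq_eq (Lp.aestronglyMeasurable ψ).aemeasurable
    (continuous_firstHarmonic d).aemeasurable (ae_of_all _ (abs_firstHarmonic_le d)) hδ h
  exact zero_mem_eigenvaluesNeil_of_mul_sq_eq hd hs

theorem ae_half_turn {p : Torus → Prop} (h : ∀ᵐ t ∂arc, p t) :
    ∀ᵐ t ∂arc, p (t + (2 * Real.pi / 2 : ℝ)) :=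
  (measurePreserving_add_right arc _).quasiMeasurePreserving.ae h

theorem not_ae_firstHarmonic_pos (c : ℂ) : ¬ ∀ᵐ t ∂arc, 0 < firstHarmonic c t := by
  intro h
  obtain ⟨t, ht, ht'⟩ := (h.and (ae_half_turn h)).exists
  rw [firstHarmonic_add_half_period] at ht'
  linarith

theorem ae_min_mul_abs_firstHarmonic_le {φ : Torus → ℝ} {x y ν : ℝ} {c d : ℂ}
    (hxν : x < ν) (hνy : ν < y)
    (hc : ∀ᵐ t ∂arc, SignType.sign (φ t - x) = SignType.sign (firstHarmonic c t))
    (hd : ∀ᵐ t ∂arc, SignType.sign (φ t - y) = SignType.sign (firstHarmonic d t)) :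
    ∀ᵐ t ∂arc, min (ν - x) (y - ν) * |firstHarmonic d t| ≤ firstHarmonic d t * (φ t - ν) := by
  filter_upwards [hc, hd, ae_half_turn hc, ae_half_turn hd] with t hct hdt hct' hdt'
  rw [firstHarmonic_add_half_period, Left.sign_neg] at hct' hdt'
  obtain hneg | hzero | hpos := lt_trichotomy (firstHarmonic d t) 0
  · have opposite_gt : y < φ (t + (2 * Real.pi / 2 : ℝ)) := by
      rwa [sign_neg hneg, neg_neg, sign_eq_one_iff, sub_pos] at hdt'
    have harmonic_neg : firstHarmonic c t < 0 := by
      rwa [sign_pos (by linarith), eq_comm, neg_eq_iff_eq_neg, sign_eq_neg_one_iff] at hct'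
    have lt_x : φ t < x := by rwa [sign_neg harmonic_neg, sign_eq_neg_one_iff, sub_neg] at hct
    rw [abs_of_neg hneg]
    nlinarith [min_le_left (ν - x) (y - ν)]
  · simp [hzero]
  · have gt_y : y < φ t := by rwa [sign_pos hpos, sign_eq_one_iff, sub_pos] at hdt
    rw [abs_of_pos hpos]
    nlinarith [min_le_right (ν - x) (y - ν)]

theorem ne_zero_of_ae_sign_sub_eq {φ : Torus → ℝ} {x y : ℝ} {c d : ℂ} (hxy : x < y)
    (hc : ∀ᵐ t ∂arc, SignType.sign (φ t - x) = SignType.sign (firstHarmonic c t))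
    (hd : ∀ᵐ t ∂arc, SignType.sign (φ t - y) = SignType.sign (firstHarmonic d t)) : d ≠ 0 := by
  rintro rfl
  refine not_ae_firstHarmonic_pos c ?_
  filter_upwards [hc, hd] with t hct hdt
  rw [firstHarmonic_zero, sign_zero, sign_eq_zero_iff, sub_eq_zero] at hdt
  rwa [hdt, sign_pos (sub_pos.2 hxy), eq_comm, sign_eq_one_iff] at hct

theorem ordConnected_setOf_ofReal_mem_eigenvaluesNeil (φ : Lp ℝ ∞ arc) :
    {x : ℝ | (x : ℂ) ∈ eigenvaluesNeil φ}.OrdConnected := by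
  refine Set.ordConnected_of_Ioo fun x hx y hy hxy ν ⟨hxν, hνy⟩ => ?_
  obtain ⟨c, hc⟩ := exists_ae_sign_sub_eq_sign_firstHarmonic hx
  obtain ⟨d, hd⟩ := exists_ae_sign_sub_eq_sign_firstHarmonic hy
  refine ofReal_mem_eigenvaluesNeil_iff.2 (zero_mem_eigenvaluesNeil_of_le_mul
    (ne_zero_of_ae_sign_sub_eq hxy hc hd) (lt_min (sub_pos.2 hxν) (sub_pos.2 hνy)) ?_)
  filter_upwards [ae_min_mul_abs_firstHarmonic_le hxν hνy hc hd,
    Lp.coeFn_sub φ (Lp.const ∞ arc ν), Lp.coeFn_const (p := ∞) (μ := arc) ν] with t ht h₁ h₂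
  rwa [h₁, Pi.sub_apply, h₂]

theorem eigenvaluesNeil_eq_ofReal_image (φ : Lp ℝ ∞ arc) :
    eigenvaluesNeil φ = (fun x : ℝ => (x : ℂ)) '' {x : ℝ | (x : ℂ) ∈ eigenvaluesNeil φ} := by
  refine (Set.image_preimage_eq_of_subset fun l hl => ?_).symm
  exact Complex.conj_eq_iff_real.1 (conj_eq_self_of_mem_eigenvaluesNeil hl) |>.imp fun _ => Eq.symm

end Intervals

end NeilToeplitz
end

theorem corollary3p3 (φ : MeasureTheory.Lp ℝ ⊤ NeilToeplitz.arc) :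
    NeilToeplitz.eigenvaluesNeil φ = ∅ ∨
    (∃ x : ℝ, NeilToeplitz.eigenvaluesNeil φ = {(x : ℂ)}) ∨
    (∃ I : Set ℝ, I.OrdConnected ∧ I.Nontrivial ∧
      NeilToeplitz.eigenvaluesNeil φ = (fun x : ℝ => (x : ℂ)) '' I) := by
  have image_eq := NeilToeplitz.eigenvaluesNeil_eq_ofReal_image φ
  obtain subsingleton | nontrivial :=
    {x : ℝ | (x : ℂ) ∈ NeilToeplitz.eigenvaluesNeil φ}.subsingleton_or_nontrivial
  · obtain empty | ⟨x, singleton⟩ := subsingleton.eq_empty_or_singleton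
    · exact .inl (by rw [image_eq, empty, Set.image_empty])
    · exact .inr (.inl ⟨x, by rw [image_eq, singleton, Set.image_singleton]⟩)
  · exact .inr (.inr ⟨_, NeilToeplitz.ordConnected_setOf_ofReal_mem_eigenvaluesNeil φ, nontrivial,
      image_eq⟩)
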